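/- The Toucher-Isolator game on a finite simple graph $G$ is played as follows: two players, Toucher and Isolator, alternately claim one previously unclaimed edge of $G$, with Toucher moving first, until all edges have been claimed. A vertex is untouched if it is incident to no edge claimed by Toucher. Toucher aims to minimise, and Isolator to maximise, the number of untouched vertices at the end of the game; let $u(G)$ denote this number when both players play optimally. Then for every tree $T$ with $n > 2$ vertices, $$\frac{n+2}{8} \le u(T) \le \frac{n-1}{2}.$$ -/

import Mathlib

namespace ToucherIsolator

/-- The two players of the game; Toucher moves first. -/
inductive Player where
  | toucher
  | isolator

variable {V : Type*} [Fintype V] [DecidableEq V]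

/-- The number of vertices that are incident to no edge of `A`, where `A` is the set of edges
claimed by Toucher. -/
def untouchedCount (A : Finset (Sym2 V)) : ℕ :=
  (Finset.univ.filter fun v : V => ∀ e ∈ A, v ∉ e).card

/-- The number of untouched vertices at the end of the game under optimal play, from the position
in which player `p` is to move, Toucher has claimed the edges in `A` and the edges in `R` are
still unclaimed. The player to move claims one edge of `R`; Toucher minimises and Isolator
maximises the final number of untouched vertices. The game ends when `R` is empty. -/
def value (p : Player) (A R : Finset (Sym2 V)) : ℕ :=
  if h : R.Nonempty then
    match p with
    | .toucher =>
        R.attach.inf' (Finset.attach_nonempty_iff.mpr h)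
          fun e => value .isolator (insert e.1 A) (R.erase e.1)
    | .isolator =>
        R.attach.sup' (Finset.attach_nonempty_iff.mpr h)
          fun e => value .toucher A (R.erase e.1)
  else untouchedCount A
termination_by R.card
decreasing_by
  all_goals exact Finset.card_erase_lt_of_mem e.2

/-- `u G` is the number of untouched vertices at the end of the Toucher-Isolator game on `G`
(played on the edges of `G`, Toucher moving first) when both players play optimally. -/
def u (G : SimpleGraph V) [DecidableRel G.Adj] : ℕ :=
  value .toucher ∅ G.edgeFinset

end ToucherIsolator

namespace ToucherIsolator

/-! ### Game values and the potential, for arbitrary edge sets. -/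

section Game

variable {V : Type*} [Fintype V] [DecidableEq V]

/-! Upper bound: in a connected graph, each edge Toucher owns uses up an edge that an untouched
vertex could have as its parent edge. Toucher owns at least half of the `n - 1` edges, however both
sides play (`untouchedCount_add_card_le`, `value_add_card_le`).

Lower bound: give an untouched vertex of degree at most two the weight `2 ^ (-d)`, with `d` its
number of unclaimed edges. If Isolator always takes the heaviest edge, a round costs at most `1 / 4`
of the total, because Toucher's reply shares at most one vertex with it (`potential_sub_le_value`).
The total starts at `(n + 2) / 4` or more, and Toucher's first move costs at most `3 / 4`.
Isolator's first move can be made at no loss (`exists_lossless_move`), which supplies the remaining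
constant. -/

theorem value_empty (p : Player) (A : Finset (Sym2 V)) : value p A ∅ = untouchedCount A := by
  rw [value]; simp

theorem exists_value_toucher (A : Finset (Sym2 V)) {R : Finset (Sym2 V)} (h : R.Nonempty) :
    ∃ e ∈ R, value .toucher A R = value .isolator (insert e A) (R.erase e) := by
  rw [value, dif_pos h]
  obtain ⟨e, -, he⟩ := Finset.exists_mem_eq_inf' (Finset.attach_nonempty_iff.mpr h)
    fun e => value .isolator (insert e.1 A) (R.erase e.1)
  exact ⟨e.1, e.2, he⟩

theorem value_toucher_le (A : Finset (Sym2 V)) {R : Finset (Sym2 V)} {e : Sym2 V} (he : e ∈ R) :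
    value .toucher A R ≤ value .isolator (insert e A) (R.erase e) := by
  rw [value, dif_pos ⟨e, he⟩]
  exact Finset.inf'_le (fun e : {x // x ∈ R} => value .isolator (insert e.1 A) (R.erase e.1))
    (Finset.mem_attach R ⟨e, he⟩)

theorem exists_value_isolator (A : Finset (Sym2 V)) {R : Finset (Sym2 V)} (h : R.Nonempty) :
    ∃ e ∈ R, value .isolator A R = value .toucher A (R.erase e) := by
  rw [value, dif_pos h]
  obtain ⟨e, -, he⟩ := Finset.exists_mem_eq_sup' (Finset.attach_nonempty_iff.mpr h)
    fun e => value .toucher A (R.erase e.1)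
  exact ⟨e.1, e.2, he⟩

theorem le_value_isolator (A : Finset (Sym2 V)) {R : Finset (Sym2 V)} {e : Sym2 V} (he : e ∈ R) :
    value .toucher A (R.erase e) ≤ value .isolator A R := by
  rw [value.eq_def .isolator, dif_pos ⟨e, he⟩]
  exact Finset.le_sup' (fun e : {x // x ∈ R} => value .toucher A (R.erase e.1))
    (Finset.mem_attach R ⟨e, he⟩)

/-- If every nonempty edge set `B` leaves at most `N - |B|` vertices untouched, then the trivial
count of the edges that Toucher will own bounds the value of every position. -/
theorem value_add_card_le {E : Finset (Sym2 V)} {N : ℕ}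
    (hE : ∀ B ⊆ E, B.Nonempty → untouchedCount B + B.card ≤ N) (k : ℕ) :
    ∀ A R : Finset (Sym2 V), R.card = k → A ⊆ E → R ⊆ E → Disjoint A R →
      ((A.Nonempty ∨ R.Nonempty) → value .toucher A R + A.card + (k + 1) / 2 ≤ N) ∧
      (A.Nonempty → value .isolator A R + A.card + k / 2 ≤ N) := by
  induction k with
  | zero =>
    intro A R hk hA hR hd
    obtain rfl := Finset.card_eq_zero.mp hk
    simp only [value_empty]
    refine ⟨fun h => ?_, fun h => ?_⟩
    · have := hE A hA (by simpa using h)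
      omega
    · have := hE A hA h
      omega
  | succ k ih =>
    intro A R hk hA hR hd
    have hne : R.Nonempty := Finset.card_pos.mp (by omega)
    refine ⟨fun _ => ?_, fun h => ?_⟩
    · obtain ⟨e, he, hv⟩ := exists_value_toucher A hne
      have heA : e ∉ A := fun h => Finset.disjoint_left.mp hd h he
      have := (ih (insert e A) (R.erase e) (by rw [Finset.card_erase_of_mem he, hk]; rfl)
        (Finset.insert_subset (hR he) hA) ((Finset.erase_subset _ _).trans hR)
        (by
          rw [Finset.disjoint_insert_left]
          exact ⟨Finset.notMem_erase _ _, hd.mono_right (Finset.erase_subset _ _)⟩)).2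
        (Finset.insert_nonempty _ _)
      rw [Finset.card_insert_of_notMem heA] at this
      omega
    · obtain ⟨e, he, hv⟩ := exists_value_isolator A hne
      have := (ih A (R.erase e) (by rw [Finset.card_erase_of_mem he, hk]; rfl) hA
        ((Finset.erase_subset _ _).trans hR)
        (hd.mono_right (Finset.erase_subset _ _))).1 (Or.inl h)
      omega

/-- The chance that the vertex `v` stays untouched if the edges of `R` are claimed at random,
counted only for the vertices of `S`. -/
noncomputable def weight (S : Finset V) (A R : Finset (Sym2 V)) (v : V) : ℝ :=
  if v ∈ S ∧ ∀ e ∈ A, v ∉ e then (1 / 2) ^ (R.filter (v ∈ ·)).card else 0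

/-- The change in potential when `e` is claimed: a gain by Isolator, a loss by Toucher. -/
noncomputable def edgeWeight (S : Finset V) (A R : Finset (Sym2 V)) (e : Sym2 V) : ℝ :=
  ∑ v, if v ∈ e then weight S A R v else 0

noncomputable def commonWeight (S : Finset V) (A R : Finset (Sym2 V)) (e f : Sym2 V) : ℝ :=
  ∑ v, if v ∈ e ∧ v ∈ f then weight S A R v else 0

noncomputable def potential (S : Finset V) (A R : Finset (Sym2 V)) : ℝ :=
  ∑ v, weight S A R v

variable (S : Finset V) (A R : Finset (Sym2 V))

theorem weight_nonneg (v : V) : 0 ≤ weight S A R v := by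
  unfold weight; split_ifs <;> positivity

theorem edgeWeight_nonneg (e : Sym2 V) : 0 ≤ edgeWeight S A R e :=
  Finset.sum_nonneg fun v _ => by
    split_ifs
    exacts [weight_nonneg S A R v, le_rfl]

theorem weight_erase {f : Sym2 V} (hf : f ∈ R) (v : V) :
    weight S A (R.erase f) v = weight S A R v + if v ∈ f then weight S A R v else 0 := by
  unfold weight
  by_cases hv : v ∈ S ∧ ∀ e ∈ A, v ∉ e
  · simp only [if_pos hv]
    rw [Finset.filter_erase]
    split_ifs with h
    · have hm : f ∈ R.filter (v ∈ ·) := Finset.mem_filter.mpr ⟨hf, h⟩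
      rw [← Finset.card_erase_add_one hm, pow_succ]
      ring
    · rw [Finset.erase_eq_of_notMem (by simp [h]), add_zero]
  · simp [if_neg hv]

theorem weight_insert_erase (e : Sym2 V) (v : V) :
    weight S (insert e A) (R.erase e) v =
      weight S A R v - if v ∈ e then weight S A R v else 0 := by
  unfold weight
  by_cases h : v ∈ e
  · have : ¬ (v ∈ S ∧ ∀ e' ∈ insert e A, v ∉ e') := fun h' =>
      h'.2 e (Finset.mem_insert_self _ _) h
    rw [if_neg this, if_pos h, sub_self]
  · have : (v ∈ S ∧ ∀ e' ∈ insert e A, v ∉ e') ↔ (v ∈ S ∧ ∀ e' ∈ A, v ∉ e') := by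
      simp [h]
    simp only [this, if_neg h, sub_zero]
    rw [Finset.filter_erase, Finset.erase_eq_of_notMem (by simp [h])]

theorem potential_erase {f : Sym2 V} (hf : f ∈ R) :
    potential S A (R.erase f) = potential S A R + edgeWeight S A R f := by
  simp only [potential, edgeWeight, weight_erase S A R hf, Finset.sum_add_distrib]

theorem potential_insert_erase (e : Sym2 V) :
    potential S (insert e A) (R.erase e) = potential S A R - edgeWeight S A R e := by
  simp only [potential, edgeWeight, weight_insert_erase S A R, Finset.sum_sub_distrib]

theorem edgeWeight_erase {f : Sym2 V} (hf : f ∈ R) (e : Sym2 V) :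
    edgeWeight S A (R.erase f) e = edgeWeight S A R e + commonWeight S A R e f := by
  simp only [edgeWeight, commonWeight, weight_erase S A R hf, ← Finset.sum_add_distrib]
  refine Finset.sum_congr rfl fun v _ => ?_
  by_cases h : v ∈ e <;> simp [h]

/-- Isolator's claim of `f` doubles the weights at its ends, so a vertex shared with `e` counts
twice in Toucher's reply. -/
theorem potential_round {f : Sym2 V} (hf : f ∈ R) (e : Sym2 V) :
    potential S (insert e A) ((R.erase f).erase e) =
      potential S A R + edgeWeight S A R f - (edgeWeight S A R e + commonWeight S A R e f) := by
  rw [potential_insert_erase, potential_erase S A R hf, edgeWeight_erase S A R hf]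

/-- Distinct edges share at most one vertex, and that vertex still has two unclaimed edges. -/
theorem commonWeight_le {e f : Sym2 V} (he : e ∈ R) (hf : f ∈ R) (hne : e ≠ f) :
    commonWeight S A R e f ≤ 1 / 4 := by
  unfold commonWeight
  by_cases h : ∃ v, v ∈ e ∧ v ∈ f
  · obtain ⟨v, hve, hvf⟩ := h
    rw [Finset.sum_eq_single v]
    · rw [if_pos ⟨hve, hvf⟩]
      unfold weight
      split_ifs
      · have hc : 2 ≤ (R.filter (v ∈ ·)).card := by
          rw [← Finset.card_pair hne]
          refine Finset.card_le_card fun x hx => ?_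
          rcases Finset.mem_insert.mp hx with rfl | hx
          · exact Finset.mem_filter.mpr ⟨he, hve⟩
          · rw [Finset.mem_singleton.mp hx]
            exact Finset.mem_filter.mpr ⟨hf, hvf⟩
        calc (1 / 2 : ℝ) ^ (R.filter (v ∈ ·)).card ≤ (1 / 2) ^ 2 :=
              pow_le_pow_of_le_one (by norm_num) (by norm_num) hc
          _ = 1 / 4 := by norm_num
      · norm_num
    · intro w _ hw
      exact if_neg fun h => hne (Sym2.eq_of_ne_mem hw h.1 hve h.2 hvf)
    · simp
  · rw [Finset.sum_eq_zero fun v _ => if_neg fun hv => h ⟨v, hv⟩]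
    norm_num

theorem potential_empty_le : potential S A ∅ ≤ untouchedCount A := by
  unfold potential weight untouchedCount
  rw [Finset.card_filter, Nat.cast_sum]
  refine Finset.sum_le_sum fun v _ => ?_
  by_cases h : ∀ e ∈ A, v ∉ e
  · rw [if_pos h]
    split_ifs <;> simp
  · rw [if_neg h, if_neg (fun h' => h h'.2)]
    simp

/-- Claiming the heaviest edge, Isolator loses at most `1 / 4` of the potential per round. -/
theorem potential_sub_le_value (k : ℕ) :
    ∀ A R : Finset (Sym2 V), R.card = k →
      potential S A R - (k : ℝ) / 8 ≤ value .isolator A R := by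
  induction k using Nat.strong_induction_on with
  | _ k ih =>
    intro A R hk
    rcases R.eq_empty_or_nonempty with rfl | hne
    · rw [value_empty]
      have := potential_empty_le S A
      have : (0 : ℝ) ≤ k := k.cast_nonneg
      linarith
    · obtain ⟨f, hf, hmax⟩ := Finset.exists_max_image R (edgeWeight S A R) hne
      have hle : (value .toucher A (R.erase f) : ℝ) ≤ value .isolator A R := by
        exact_mod_cast le_value_isolator A hf
      have hk0 : (0 : ℝ) ≤ k := k.cast_nonneg
      rcases (R.erase f).eq_empty_or_nonempty with h0 | hne'
      · rw [h0, value_empty] at hle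
        have h1 := potential_empty_le S A
        have h2 := potential_erase S A R hf
        rw [h0] at h2
        have h3 := edgeWeight_nonneg S A R f
        linarith
      · obtain ⟨e, he, hv⟩ := exists_value_toucher A hne'
        have heR := Finset.mem_of_mem_erase he
        have hcard : ((R.erase f).erase e).card + 2 = k := by
          have h1 := Finset.card_erase_add_one he
          have h2 := Finset.card_erase_add_one hf
          omega
        have h1 := ih ((R.erase f).erase e).card (by omega) (insert e A) _ rfl
        rw [potential_round S A R hf] at h1
        have h2 := commonWeight_le S A R heR hf (Finset.ne_of_mem_erase he)
        have h3 := hmax e heR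
        rw [hv] at hle
        have h4 : (((R.erase f).erase e).card : ℝ) + 2 = k := by exact_mod_cast hcard
        linarith

/-- A round without loss of potential saves `1 / 4` over `potential_sub_le_value`. -/
theorem potential_sub_le_value_of_lossless {f : Sym2 V} (hf : f ∈ R)
    (hhalf : 1 / 2 ≤ edgeWeight S A R f)
    (h : ∀ e ∈ R, e ≠ f → edgeWeight S A R e + commonWeight S A R e f ≤ edgeWeight S A R f) :
    potential S A R - ((R.card : ℝ) - 2) / 8 ≤ value .isolator A R := by
  have hle : (value .toucher A (R.erase f) : ℝ) ≤ value .isolator A R := by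
    exact_mod_cast le_value_isolator A hf
  have hk0 : (0 : ℝ) ≤ R.card := Nat.cast_nonneg _
  -- If Toucher has no reply, the claimed bound can exceed the potential; the gain of `1 / 2` from
  -- `f` covers this.
  rcases (R.erase f).eq_empty_or_nonempty with h0 | hne'
  · rw [h0, value_empty] at hle
    have h1 := potential_empty_le S A
    have h2 := potential_erase S A R hf
    rw [h0] at h2
    linarith
  · obtain ⟨e, he, hv⟩ := exists_value_toucher A hne'
    have heR := Finset.mem_of_mem_erase he
    have hcard : ((R.erase f).erase e).card + 2 = R.card := by
      have h1 := Finset.card_erase_add_one he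
      have h2 := Finset.card_erase_add_one hf
      omega
    have h1 := potential_sub_le_value S ((R.erase f).erase e).card (insert e A) _ rfl
    rw [potential_round S A R hf] at h1
    have h3 := h e heR (Finset.ne_of_mem_erase he)
    rw [hv] at hle
    have h4 : (((R.erase f).erase e).card : ℝ) + 2 = R.card := by exact_mod_cast hcard
    linarith

theorem edgeWeight_mk {a b : V} (hab : a ≠ b) :
    edgeWeight S A R s(a, b) = weight S A R a + weight S A R b := by
  unfold edgeWeight
  rw [← Finset.sum_filter, show Finset.univ.filter (· ∈ s(a, b)) = {a, b} by ext; simp,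
    Finset.sum_pair hab]

theorem commonWeight_mk {a b : V} {e : Sym2 V} (ha : a ∉ e) :
    commonWeight S A R e s(a, b) = if b ∈ e then weight S A R b else 0 := by
  unfold commonWeight
  rw [Finset.sum_eq_single b]
  · simp
  · intro v _ hv
    refine if_neg fun h => ?_
    rcases Sym2.mem_iff.mp h.2 with rfl | rfl
    exacts [ha h.1, hv rfl]
  · simp

end Game

/-! ### Connected graphs and trees. -/

section Tree

variable {V : Type*} {T : SimpleGraph V}

theorem forall_of_adj_closed (hT : T.Preconnected) {P : V → Prop} {a : V} (ha : P a)
    (hP : ∀ x y, T.Adj x y → P x → P y) (v : V) : P v := by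
  obtain ⟨w⟩ := hT a v
  induction w with
  | nil => exact ha
  | cons h _ ih => exact ih (hP _ _ h ha)

theorem exists_adj_dist_lt (hT : T.Connected) {r v : V} (h : v ≠ r) :
    ∃ w, T.Adj v w ∧ T.dist w r < T.dist v r := by
  obtain ⟨p, hp⟩ := hT.exists_walk_length_eq_dist v r
  cases p with
  | nil => exact absurd rfl h
  | cons hadj q =>
    refine ⟨_, hadj, ?_⟩
    have := SimpleGraph.dist_le q
    rw [SimpleGraph.Walk.length_cons] at hp
    omega

variable [Fintype V] [DecidableRel T.Adj]

theorem eq_of_degree_eq_one {a b c : V} (h : T.degree a = 1) (hb : T.Adj a b) (hc : T.Adj a c) :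
    b = c :=
  (SimpleGraph.degree_eq_one_iff_existsUnique_adj.mp h).unique hb hc

theorem one_le_degree (hT : T.IsTree) (hn : 2 < Fintype.card V) (v : V) : 1 ≤ T.degree v := by
  have : Nontrivial V := Fintype.one_lt_card_iff_nontrivial.mp (by omega)
  exact hT.connected.preconnected.degree_pos_of_nontrivial v

variable [DecidableEq V]

/-- Root the graph at an end `r` of an edge of `A`. Sending an untouched vertex to the edge towards
a neighbour nearer `r` is injective and avoids `A`. -/
theorem untouchedCount_add_card_le (hT : T.Connected) {A : Finset (Sym2 V)}
    (hA : A ⊆ T.edgeFinset) (hne : A.Nonempty) :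
    untouchedCount A + A.card ≤ T.edgeFinset.card := by
  obtain ⟨e, he⟩ := hne
  induction e using Sym2.ind with
  | _ r q =>
    have hex : ∀ v, ∃ w, v ≠ r → T.Adj v w ∧ T.dist w r < T.dist v r := fun v => by
      by_cases h : v = r
      · exact ⟨v, fun h' => absurd h h'⟩
      · obtain ⟨w, hw⟩ := exists_adj_dist_lt hT h
        exact ⟨w, fun _ => hw⟩
    choose p hp using hex
    rw [← Finset.card_sdiff_add_card_eq_card hA]
    refine Nat.add_le_add_right ?_ _
    have hr : ∀ v, (∀ e ∈ A, v ∉ e) → v ≠ r := by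
      rintro v hv rfl
      exact hv _ he (Sym2.mem_mk_left _ _)
    refine Finset.card_le_card_of_injOn (fun v => s(v, p v)) (fun v hv => ?_)
      fun v hv w hw hvw => ?_
    · have hv' : ∀ e ∈ A, v ∉ e := by simpa using hv
      simp only [Finset.coe_sdiff, Set.mem_sdiff, Finset.mem_coe, SimpleGraph.mem_edgeFinset,
        SimpleGraph.mem_edgeSet]
      exact ⟨(hp v (hr v hv')).1, fun h => hv' _ h (Sym2.mem_mk_left _ _)⟩
    · have hv' : ∀ e ∈ A, v ∉ e := by simpa using hv
      have hw' : ∀ e ∈ A, w ∉ e := by simpa using hw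
      have h1 := (hp v (hr v hv')).2
      have h2 := (hp w (hr w hw')).2
      -- In the swapped case each of `v`, `w` would be nearer to `r` than the other.
      rcases Sym2.eq_iff.mp hvw with h | ⟨h, h'⟩
      · exact h.1
      · rw [h'] at h1
        rw [← h] at h2
        omega

theorem u_le_of_isTree (hT : T.IsTree) (hn : 2 < Fintype.card V) :
    2 * u T + 1 ≤ Fintype.card V := by
  have hc := hT.card_edgeFinset
  have hne : T.edgeFinset.Nonempty := Finset.card_pos.mp (by omega)
  have := (value_add_card_le (fun B hB => untouchedCount_add_card_le hT.connected hB) _ ∅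
    T.edgeFinset rfl (Finset.empty_subset _) subset_rfl (Finset.disjoint_empty_left _)).1
    (Or.inr hne)
  rw [Finset.card_empty] at this
  unfold u
  omega

/-! ### Leaves. -/

theorem card_le_two_of_adj_leaves (hT : T.Preconnected) {a b : V} (hab : T.Adj a b)
    (ha : T.degree a = 1) (hb : T.degree b = 1) : Fintype.card V ≤ 2 := by
  have h := forall_of_adj_closed hT (P := fun v => v = a ∨ v = b) (Or.inl rfl) (by
    rintro x y hxy (rfl | rfl)
    · exact Or.inr (eq_of_degree_eq_one ha hxy hab)
    · exact Or.inl (eq_of_degree_eq_one hb hxy hab.symm))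
  have : (Finset.univ : Finset V) ⊆ {a, b} := fun v _ => by simpa using h v
  exact (Finset.card_le_card this).trans Finset.card_le_two

/-- If `v` has degree two and both of its neighbours are leaves, then every edge contains `v`. -/
theorem mem_of_leaves_adj (hT : T.Preconnected) {a v b : V} (hab : a ≠ b) (hva : T.Adj v a)
    (hvb : T.Adj v b) (hv : T.degree v ≤ 2) (ha : T.degree a = 1) (hb : T.degree b = 1)
    {e : Sym2 V} (he : e ∈ T.edgeSet) : v ∈ e := by
  have hN : ({a, b} : Finset V) = T.neighborFinset v := by
    refine Finset.eq_of_subset_of_card_le (fun x hx => ?_) ?_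
    · rw [SimpleGraph.mem_neighborFinset]
      rcases Finset.mem_insert.mp hx with rfl | hx
      · exact hva
      · rwa [Finset.mem_singleton.mp hx]
    · rwa [Finset.card_pair hab, SimpleGraph.card_neighborFinset_eq_degree]
  have h := forall_of_adj_closed hT (P := fun x => x = v ∨ x = a ∨ x = b) (Or.inl rfl) (by
    rintro x y hxy (rfl | rfl | rfl)
    · have : y ∈ ({a, b} : Finset V) := by rwa [hN, SimpleGraph.mem_neighborFinset]
      exact Or.inr (by simpa using this)
    · exact Or.inl (eq_of_degree_eq_one ha hxy hva.symm)
    · exact Or.inl (eq_of_degree_eq_one hb hxy hvb.symm))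
  induction e using Sym2.ind with
  | _ p q =>
    rw [SimpleGraph.mem_edgeSet] at he
    rcases h p with rfl | rfl | rfl
    · exact Sym2.mem_mk_left _ _
    · rw [eq_of_degree_eq_one ha he hva.symm]
      exact Sym2.mem_mk_right _ _
    · rw [eq_of_degree_eq_one hb he hvb.symm]
      exact Sym2.mem_mk_right _ _

/-- The sum of `2 - d(v)` is `2`, and only leaves contribute positively, one each. -/
theorem two_le_card_leaves (hT : T.IsTree) (hn : 2 < Fintype.card V) :
    2 ≤ (Finset.univ.filter fun v => T.degree v = 1).card := by
  have hc := hT.card_edgeFinset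
  have hs := T.sum_degrees_eq_twice_card_edges
  have h : ∑ _v : V, 2 ≤ ∑ v, (T.degree v + if T.degree v = 1 then 1 else 0) := by
    refine Finset.sum_le_sum fun v _ => ?_
    have := one_le_degree hT hn v
    split_ifs <;> omega
  rw [Finset.sum_add_distrib, ← Finset.card_filter, hs, Finset.sum_const, Finset.card_univ,
    smul_eq_mul] at h
  omega

theorem exists_leaf_notMem (hT : T.IsTree) (hn : 2 < Fintype.card V) {e : Sym2 V}
    (he : e ∈ T.edgeSet) : ∃ a, T.degree a = 1 ∧ a ∉ e := by
  by_contra! h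
  obtain ⟨a, ha, b, hb, hab⟩ := Finset.one_lt_card.mp (two_le_card_leaves hT hn)
  have ha := (Finset.mem_filter.mp ha).2
  have hb := (Finset.mem_filter.mp hb).2
  obtain rfl := (Sym2.mem_and_mem_iff hab).mp ⟨h a ha, h b hb⟩
  have := card_le_two_of_adj_leaves hT.connected.preconnected he ha hb
  omega

-- Dropping degrees above two does not hurt the bound on the initial potential, and it makes the
-- lossless move possible: a branch vertex of positive weight with two leaves would spoil it.
variable (T) in
def lowDegree : Finset V := Finset.univ.filter fun v => T.degree v ≤ 2

/-! ### The potential before and after Toucher's first move. -/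

theorem weight_initial (v : V) :
    weight (lowDegree T) ∅ T.edgeFinset v = if T.degree v ≤ 2 then (1 / 2) ^ T.degree v else 0 := by
  unfold weight lowDegree
  rw [← SimpleGraph.incidenceFinset_eq_filter, SimpleGraph.card_incidenceFinset_eq_degree]
  simp

theorem weight_second {e : Sym2 V} (v : V) :
    weight (lowDegree T) {e} (T.edgeFinset.erase e) v =
      if T.degree v ≤ 2 ∧ v ∉ e then (1 / 2) ^ T.degree v else 0 := by
  have h := weight_insert_erase (lowDegree T) ∅ T.edgeFinset e v
  rw [insert_empty_eq] at h
  rw [h, weight_initial]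
  by_cases h1 : v ∈ e <;> by_cases h2 : T.degree v ≤ 2 <;> simp [h1, h2]

/-- The line `(3 - d) / 4` agrees with `2 ^ (-d)` at `d = 1, 2` and is at most `0` from `d = 3` on;
its sum needs only the degree sum `2 (n - 1)`. -/
theorem le_potential_initial (hT : T.IsTree) (hn : 2 < Fintype.card V) :
    ((Fintype.card V : ℝ) + 2) / 4 ≤ potential (lowDegree T) ∅ T.edgeFinset := by
  have hc : (T.edgeFinset.card : ℝ) + 1 = Fintype.card V := by exact_mod_cast hT.card_edgeFinset
  have hs : ∑ v, (T.degree v : ℝ) = 2 * T.edgeFinset.card := by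
    exact_mod_cast T.sum_degrees_eq_twice_card_edges
  have h : ∑ v, (3 - (T.degree v : ℝ)) / 4 ≤ potential (lowDegree T) ∅ T.edgeFinset := by
    refine Finset.sum_le_sum fun v _ => ?_
    rw [weight_initial]
    have h1 := one_le_degree hT hn v
    split_ifs with h2
    · interval_cases T.degree v <;> norm_num
    · have : (3 : ℝ) ≤ T.degree v := by exact_mod_cast (by omega : 3 ≤ T.degree v)
      linarith
  rw [← Finset.sum_div, Finset.sum_sub_distrib, hs, Finset.sum_const, Finset.card_univ,
    nsmul_eq_mul] at h
  linarith

theorem half_pow_le_quarter {d : ℕ} (h : 2 ≤ d) : (1 / 2 : ℝ) ^ d ≤ 1 / 4 :=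
  (pow_le_pow_of_le_one (by norm_num) (by norm_num) h).trans (by norm_num)

/-- At most one end is a leaf, so the ends weigh at most `1 / 2` and `1 / 4`. -/
theorem edgeWeight_initial_le (hT : T.IsTree) (hn : 2 < Fintype.card V) {e : Sym2 V}
    (he : e ∈ T.edgeSet) : edgeWeight (lowDegree T) ∅ T.edgeFinset e ≤ 3 / 4 := by
  induction e using Sym2.ind with
  | _ a b =>
    rw [SimpleGraph.mem_edgeSet] at he
    have hq : ∀ v, T.degree v ≠ 1 → weight (lowDegree T) ∅ T.edgeFinset v ≤ 1 / 4 := by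
      intro v hv
      have := one_le_degree hT hn v
      rw [weight_initial]
      split_ifs
      · exact half_pow_le_quarter (by omega)
      · norm_num
    have hh : ∀ v, weight (lowDegree T) ∅ T.edgeFinset v ≤ 1 / 2 := by
      intro v
      by_cases hv : T.degree v = 1
      · rw [weight_initial, hv]
        norm_num
      · exact (hq v hv).trans (by norm_num)
    rw [edgeWeight_mk _ _ _ he.ne]
    by_cases ha : T.degree a = 1
    · have hb : T.degree b ≠ 1 := fun hb => by
        have := card_le_two_of_adj_leaves hT.connected.preconnected he ha hb
        omega
      linarith [hh a, hq b hb]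
    · linarith [hh b, hq a ha]

/-- After Toucher's first move, Isolator has a move at a leaf to which no answer of Toucher
decreases the potential. -/
theorem exists_lossless_move (hT : T.IsTree) (hn : 2 < Fintype.card V) {e₀ : Sym2 V}
    (he₀ : e₀ ∈ T.edgeSet) :
    ∃ f ∈ T.edgeFinset.erase e₀,
      1 / 2 ≤ edgeWeight (lowDegree T) {e₀} (T.edgeFinset.erase e₀) f ∧
      ∀ e ∈ T.edgeFinset.erase e₀, e ≠ f →
        edgeWeight (lowDegree T) {e₀} (T.edgeFinset.erase e₀) e +
          commonWeight (lowDegree T) {e₀} (T.edgeFinset.erase e₀) e f ≤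
        edgeWeight (lowDegree T) {e₀} (T.edgeFinset.erase e₀) f := by
  set S := lowDegree T
  set R := T.edgeFinset.erase e₀ with hR
  have hleaf : ∀ v, T.degree v = 1 → v ∉ e₀ → weight S {e₀} R v = 1 / 2 := by
    intro v h1 h2
    rw [weight_second, if_pos ⟨by omega, h2⟩, h1, pow_one]
  have hquarter : ∀ v, ¬ (T.degree v = 1 ∧ v ∉ e₀) → weight S {e₀} R v ≤ 1 / 4 := by
    intro v h
    have := one_le_degree hT hn v
    rw [weight_second]
    split_ifs with h'
    · exact half_pow_le_quarter (by by_contra hlt; exact h ⟨by omega, h'.2⟩)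
    · norm_num
  have hadj : ∀ {a b}, s(a, b) ∈ R → T.Adj a b := fun h => by
    simpa using Finset.mem_of_mem_erase h
  -- The move is a heaviest edge among those at an untouched leaf.
  obtain ⟨f, hfF, hmax⟩ := Finset.exists_max_image
    (R.filter fun f => ∃ a ∈ f, T.degree a = 1 ∧ a ∉ e₀) (edgeWeight S {e₀} R) (by
      obtain ⟨a, ha, hae⟩ := exists_leaf_notMem hT hn he₀
      obtain ⟨b, hab⟩ := (SimpleGraph.degree_eq_one_iff_existsUnique_adj.mp ha).exists
      refine ⟨s(a, b), Finset.mem_filter.mpr ⟨Finset.mem_erase.mpr ⟨?_, by simpa using hab⟩,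
        a, Sym2.mem_mk_left _ _, ha, hae⟩⟩
      rintro rfl
      exact hae (Sym2.mem_mk_left _ _))
  obtain ⟨hfR, a, haf, ha1, hae₀⟩ := Finset.mem_filter.mp hfF
  obtain ⟨v, rfl⟩ := Sym2.mem_iff_exists.mp haf
  have hav := hadj hfR
  have hwf : edgeWeight S {e₀} R s(a, v) = 1 / 2 + weight S {e₀} R v := by
    rw [edgeWeight_mk _ _ _ hav.ne, hleaf a ha1 hae₀]
  have hv0 := weight_nonneg S {e₀} R v
  refine ⟨s(a, v), hfR, by linarith, fun e he hne => ?_⟩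
  have hae : a ∉ e := fun h => by
    obtain ⟨w, rfl⟩ := Sym2.mem_iff_exists.mp h
    exact hne (by rw [eq_of_degree_eq_one ha1 (hadj he) hav])
  rw [commonWeight_mk _ _ _ hae]
  split_ifs with hve
  · obtain ⟨y, rfl⟩ := Sym2.mem_iff_exists.mp hve
    have hvy := hadj he
    have hay : a ≠ y := fun h => hae (h ▸ Sym2.mem_mk_right _ _)
    rw [hwf, edgeWeight_mk _ _ _ hvy.ne]
    -- It suffices that `v` and `y` together weigh at most `1 / 2`. If `v` has positive weight, `y`
    -- is not an untouched leaf: otherwise every edge, `e₀` included, would contain `v`.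
    by_cases hv : T.degree v ≤ 2 ∧ v ∉ e₀
    · have hv2 : T.degree v ≠ 1 := fun h => hay (eq_of_degree_eq_one h hav.symm hvy)
      have hy : ¬ (T.degree y = 1 ∧ y ∉ e₀) := fun hy =>
        hv.2 (mem_of_leaves_adj hT.connected.preconnected hay hav.symm hvy hv.1 ha1 hy.1 he₀)
      linarith [hquarter y hy, hquarter v fun h => hv2 h.1]
    · have hwv : weight S {e₀} R v = 0 := by rw [weight_second, if_neg hv]
      have hwy : weight S {e₀} R y ≤ 1 / 2 := by
        by_cases hy : T.degree y = 1 ∧ y ∉ e₀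
        · exact (hleaf y hy.1 hy.2).le
        · exact (hquarter y hy).trans (by norm_num)
      linarith
  · rw [add_zero]
    by_cases hF : ∃ b ∈ e, T.degree b = 1 ∧ b ∉ e₀
    · exact hmax e (Finset.mem_filter.mpr ⟨he, hF⟩)
    -- Without an untouched leaf, both ends weigh at most `1 / 4`.
    · induction e using Sym2.ind with
      | _ b c =>
        rw [edgeWeight_mk _ _ _ (hadj he).ne, hwf]
        linarith [hquarter b fun h => hF ⟨b, Sym2.mem_mk_left _ _, h⟩,
          hquarter c fun h => hF ⟨c, Sym2.mem_mk_right _ _, h⟩]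

theorem le_u_of_isTree (hT : T.IsTree) (hn : 2 < Fintype.card V) :
    ((Fintype.card V : ℝ) + 2) / 8 ≤ u T := by
  have hcard := hT.card_edgeFinset
  have hne : T.edgeFinset.Nonempty := Finset.card_pos.mp (by omega)
  obtain ⟨e, he, hv⟩ := exists_value_toucher ∅ hne
  have he' : e ∈ T.edgeSet := SimpleGraph.mem_edgeFinset.mp he
  obtain ⟨f, hf, hhalf, hloss⟩ := exists_lossless_move hT hn he'
  have h1 := potential_sub_le_value_of_lossless _ _ _ hf hhalf hloss
  have h2 := potential_insert_erase (lowDegree T) ∅ T.edgeFinset e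
  rw [insert_empty_eq] at h2 hv
  have h3 := le_potential_initial hT hn
  have h4 := edgeWeight_initial_le hT hn he'
  have h5 : ((T.edgeFinset.erase e).card : ℝ) + 2 = Fintype.card V := by
    have := Finset.card_erase_add_one he
    exact_mod_cast (by omega : (T.edgeFinset.erase e).card + 2 = Fintype.card V)
  rw [u, hv]
  -- The count is `(n + 2) / 4 - 3 / 4 - (n - 4) / 8 = (n + 2) / 8`.
  linarith

end Tree

end ToucherIsolator

theorem theorem6 {V : Type*} [Fintype V] [DecidableEq V] (T : SimpleGraph V)
    [DecidableRel T.Adj] (hT : T.IsTree) (hn : 2 < Fintype.card V) :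
    ((Fintype.card V : ℝ) + 2) / 8 ≤ (ToucherIsolator.u T : ℝ) ∧
      (ToucherIsolator.u T : ℝ) ≤ ((Fintype.card V : ℝ) - 1) / 2 := by
  refine ⟨ToucherIsolator.le_u_of_isTree hT hn, ?_⟩
  have h : (2 * ToucherIsolator.u T + 1 : ℝ) ≤ Fintype.card V := by
    exact_mod_cast ToucherIsolator.u_le_of_isTree hT hn
  linarith
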